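/- Let $G$ and $F$ be finite groups and let $H=\mathbb{C}^{G}\#_{\sigma}^{\tau}\mathbb{C}F$ be a cocentral abelian extension with antipode $S$. That is, $F$ acts on $G$ by group automorphisms, written $x\rightharpoonup g$; for $x,y\in F$ and $a,b,g\in G$ we are given nonzero scalars $\sigma_g(x,y),\tau_x(a,b)\in\mathbb{C}^\times$ that are normalized ($\sigma_g(1,x)=\sigma_g(x,1)=1=\tau_x(1,a)=\tau_x(a,1)$) and satisfy $$\sigma_g(x,y)\,\sigma_g(xy,z)=\sigma_{x^{-1}\rightharpoonup g}(y,z)\,\sigma_g(x,yz),\qquad \tau_x(a,b)\,\tau_x(ab,c)=\tau_x(a,bc)\,\tau_x(b,c),$$ $$\sigma_{ab}(x,y)\,\tau_{xy}(a,b)=\sigma_a(x,y)\,\sigma_b(x,y)\,\tau_x(a,b)\,\tau_y(x^{-1}\rightharpoonup a,\,x^{-1}\rightharpoonup b)$$ for all $x,y,z\in F$ and $a,b,c,g\in G$; and $H$ is the Hopf algebra over $\mathbb{C}$ with basis $\{p_g\# x : g\in G,\ x\in F\}$, multiplication $(p_g\# x)(p_h\# y)=\delta_{g,\,x\rightharpoonup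 h}\,\sigma_g(x,y)\,p_g\# xy$, unit $\sum_{g}p_g\#1$, comultiplication $\Delta(p_g\# x)=\sum_{ab=g}\tau_x(a,b)\,(p_a\# x)\otimes(p_b\# x)$ and counit $\varepsilon(p_g\# x)=\delta_{g,1}$. For a group $L$ put $I_L=\{l\in L : l^2=1\}$ (so the identity is counted as an involution) and $i_L=|I_L|$. For $g\in G$ let $F_g=\{w\in F: w\rightharpoonup g=g\}$ be the stabilizer of $g$ and $\widetilde{F_g}=\{w\in F : w\rightharpoonup g=g \text{ or } w\rightharpoonup g=g^{-1}\}$. (i) If $|F|$ is odd, then $\operatorname{Tr}(S)=i_G$. (ii) If the cocycle $\sigma$ is trivial (all $\sigma_g(x,y)=1$), the set $I_F$ is a subgroup of $F$, and $F_g=\widetilde{F_g}$ for all $g\in G$, then $\operatorname{Tr}(S)$ is a positive real number. -/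

import Mathlib

open scoped TensorProduct ComplexOrder

noncomputable section

universe u v

/-- The data of a cocentral abelian extension `ℂ^G #_σ^τ ℂF`, that is, of an abelian extension whose
coaction is trivial: the group `F` acts on the group `G` by automorphisms (the action
`x ⇀ g` is written `x • g`), `σ : F × F → (ℂ^G)ˣ` is a normalized `2`-cocycle,
`σ(x, y) = ∑ g, σ_g(x, y) p_g`, and `τ : F → (ℂ^G ⊗ ℂ^G)ˣ` is a normalized dual `2`-cocycle,
`τ(x) = ∑ a b, τ_x(a, b) p_a ⊗ p_b`, subject to the usual compatibility condition.
Here `σ g x y` is `σ_g(x, y)` and `τ x a b` is `τ_x(a, b)`. -/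
structure CocentralDatum (G : Type u) (F : Type v) [Group G] [Group F]
    [MulDistribMulAction F G] where
  σ : G → F → F → ℂˣ
  τ : F → G → G → ℂˣ
  σ_one_left : ∀ g x, σ g 1 x = 1
  σ_one_right : ∀ g x, σ g x 1 = 1
  σ_cocycle : ∀ g x y z, σ g x y * σ g (x * y) z = σ (x⁻¹ • g) y z * σ g x (y * z)
  τ_one_left : ∀ x a, τ x 1 a = 1
  τ_one_right : ∀ x a, τ x a 1 = 1
  τ_cocycle : ∀ x a b c, τ x a b * τ x (a * b) c = τ x a (b * c) * τ x b c
  compat : ∀ x y a b,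
    σ (a * b) x y * τ (x * y) a b =
      σ a x y * σ b x y * (τ x a b * τ y (x⁻¹ • a) (x⁻¹ • b))

namespace CocentralDatum

variable {G : Type u} {F : Type v} [Group G] [Group F] [MulDistribMulAction F G]

theorem τ_one (D : CocentralDatum G F) (a b : G) : D.τ 1 a b = 1 := by
  have h := D.compat 1 1 a b
  simpa [D.σ_one_left] using h

theorem σ_one (D : CocentralDatum G F) (x y : F) : D.σ 1 x y = 1 := by
  have h := D.compat x y 1 1
  simpa [D.τ_one_left] using h

theorem τ_inv (D : CocentralDatum G F) (x : F) (g : G) : D.τ x g g⁻¹ = D.τ x g⁻¹ g := by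
  have h := D.τ_cocycle x g g⁻¹ g
  simpa [D.τ_one_left, D.τ_one_right] using h

theorem σ_inv (D : CocentralDatum G F) (x : F) (g : G) :
    D.σ g x x⁻¹ = D.σ (x⁻¹ • g) x⁻¹ x := by
  have h := D.σ_cocycle g x x⁻¹ x
  simpa [D.σ_one_left, D.σ_one_right] using h

/-- The underlying vector space of `ℂ^G #_σ^τ ℂF`, with basis the elements `p_g # x` for
`g : G` and `x : F`. -/
def Ext (_D : CocentralDatum G F) : Type (max u v) := (G × F) →₀ ℂ

instance (D : CocentralDatum G F) : AddCommGroup D.Ext :=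
  inferInstanceAs (AddCommGroup ((G × F) →₀ ℂ))

instance (D : CocentralDatum G F) : Module ℂ D.Ext :=
  inferInstanceAs (Module ℂ ((G × F) →₀ ℂ))

/-- The basis of the elements `p_g # x`. -/
def basis (D : CocentralDatum G F) : Module.Basis (G × F) ℂ D.Ext :=
  Module.Basis.ofRepr (LinearEquiv.refl ℂ ((G × F) →₀ ℂ))

/-- The basis element `p_g # x`. -/
def p (D : CocentralDatum G F) (g : G) (x : F) : D.Ext := D.basis (g, x)

/-- Two linear maps out of `ℂ^G #_σ^τ ℂF` agree if they agree on all `p_g # x`. -/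
theorem hom_ext {D : CocentralDatum G F} {M : Type*} [AddCommMonoid M] [Module ℂ M]
    {f f' : D.Ext →ₗ[ℂ] M} (h : ∀ g x, f (D.p g x) = f' (D.p g x)) : f = f' :=
  D.basis.ext fun i => h i.1 i.2

open Classical in
/-- Multiplication: `(p_g # x)(p_h # y) = δ_{g, x ⇀ h} σ_g(x, y) p_g # xy`. -/
def mulHom (D : CocentralDatum G F) : D.Ext →ₗ[ℂ] D.Ext →ₗ[ℂ] D.Ext :=
  D.basis.constr ℂ fun i => D.basis.constr ℂ fun j =>
    if i.1 = i.2 • j.1 then (D.σ i.1 i.2 j.2 : ℂ) • D.p i.1 (i.2 * j.2) else 0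

open Classical in
theorem mulHom_p (D : CocentralDatum G F) (g h : G) (x y : F) :
    D.mulHom (D.p g x) (D.p h y) =
      if g = x • h then (D.σ g x y : ℂ) • D.p g (x * y) else 0 := by
  simp [mulHom, p]

/-- The unit: `∑ g, p_g # 1`. -/
def unit (D : CocentralDatum G F) [Fintype G] : D.Ext := ∑ g : G, D.p g 1

theorem mulHom_unit_left (D : CocentralDatum G F) [Fintype G] (a : D.Ext) :
    D.mulHom D.unit a = a := by
  have : D.mulHom D.unit = LinearMap.id := by
    apply hom_ext
    intro g x
    simp only [unit, map_sum, LinearMap.sum_apply, mulHom_p, LinearMap.id_apply]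
    rw [Finset.sum_eq_single g]
    · simp [D.σ_one_left]
    · intro b _ hb
      rw [one_smul, if_neg hb]
    · simp
  rw [this]; rfl

theorem mulHom_unit_right (D : CocentralDatum G F) [Fintype G] (a : D.Ext) :
    D.mulHom a D.unit = a := by
  have : D.mulHom.flip D.unit = LinearMap.id := by
    apply hom_ext
    intro g x
    rw [LinearMap.flip_apply]
    simp only [unit, map_sum, mulHom_p, LinearMap.id_apply]
    rw [Finset.sum_eq_single (x⁻¹ • g)]
    · simp [D.σ_one_right]
    · intro b _ hb
      rw [if_neg]
      intro e; exact hb (by rw [e, inv_smul_smul])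
    · simp
  exact LinearMap.congr_fun this a

theorem mulHom_assoc (D : CocentralDatum G F) (a b c : D.Ext) :
    D.mulHom (D.mulHom a b) c = D.mulHom a (D.mulHom b c) := by
  have : D.mulHom.compr₂ D.mulHom =
      ((LinearMap.llcomp ℂ D.Ext D.Ext D.Ext).flip ∘ₗ D.mulHom).flip ∘ₗ D.mulHom := by
    apply hom_ext; intro g x
    apply hom_ext; intro h y
    apply hom_ext; intro k z
    simp only [LinearMap.compr₂_apply, LinearMap.comp_apply, LinearMap.flip_apply,
      LinearMap.llcomp_apply, mulHom_p]
    by_cases h1 : g = x • h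
    · by_cases h2 : h = y • k
      · have h3 : g = (x * y) • k := by rw [h1, h2, mul_smul]
        have hc := congrArg (fun u : ℂˣ => (u : ℂ)) (D.σ_cocycle g x y z)
        have hh : x⁻¹ • g = h := by rw [h1, inv_smul_smul]
        simp only [hh, Units.val_mul] at hc
        rw [if_pos h1, if_pos h2]
        simp only [map_smul, LinearMap.smul_apply, mulHom_p]
        rw [if_pos h3, if_pos h1, smul_smul, smul_smul, hc, mul_assoc x y z]
      · have h3 : ¬ g = (x * y) • k := by
          rw [h1, mul_smul]; intro e; exact h2 (MulAction.injective x e)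
        rw [if_pos h1, if_neg h2]
        simp [mulHom_p, h3]
    · rw [if_neg h1]
      by_cases h2 : h = y • k
      · rw [if_pos h2]; simp [mulHom_p, h1]
      · rw [if_neg h2]; simp
  exact LinearMap.congr_fun (LinearMap.congr_fun (LinearMap.congr_fun this a) b) c

/-- The algebra `ℂ^G #_σ ℂF`. -/
instance (D : CocentralDatum G F) [Fintype G] : Ring D.Ext :=
  { (inferInstance : AddCommGroup D.Ext) with
    mul := fun a b => D.mulHom a b
    one := D.unit
    left_distrib := fun a b c => map_add (D.mulHom a) b c
    right_distrib := fun a b c => LinearMap.map_add₂ D.mulHom a b c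
    zero_mul := fun a => LinearMap.map_zero₂ D.mulHom a
    mul_zero := fun a => map_zero (D.mulHom a)
    mul_assoc := D.mulHom_assoc
    one_mul := D.mulHom_unit_left
    mul_one := D.mulHom_unit_right }

theorem mul_def (D : CocentralDatum G F) [Fintype G] (a b : D.Ext) : a * b = D.mulHom a b := rfl

theorem one_def (D : CocentralDatum G F) [Fintype G] : (1 : D.Ext) = ∑ g : G, D.p g 1 := rfl

instance (D : CocentralDatum G F) [Fintype G] : Algebra ℂ D.Ext :=
  Algebra.ofModule (fun r a b => LinearMap.map_smul₂ D.mulHom r a b)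
    (fun r a b => map_smul (D.mulHom a) r b)

open Classical in
theorem p_mul_p (D : CocentralDatum G F) [Fintype G] (g h : G) (x y : F) :
    D.p g x * D.p h y = if g = x • h then (D.σ g x y : ℂ) • D.p g (x * y) else 0 :=
  D.mulHom_p g h x y

/-- Comultiplication: `Δ(p_g # x) = ∑_{ab = g} τ_x(a, b) (p_a # x) ⊗ (p_b # x)`. -/
def comulHom (D : CocentralDatum G F) [Fintype G] : D.Ext →ₗ[ℂ] D.Ext ⊗[ℂ] D.Ext :=
  D.basis.constr ℂ fun i => ∑ a : G,
    (D.τ i.2 a (a⁻¹ * i.1) : ℂ) • (D.p a i.2 ⊗ₜ[ℂ] D.p (a⁻¹ * i.1) i.2)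

open Classical in
/-- Counit: `ε(p_g # x) = δ_{g, 1}`. -/
def counitHom (D : CocentralDatum G F) : D.Ext →ₗ[ℂ] ℂ :=
  D.basis.constr ℂ fun i => if i.1 = 1 then 1 else 0

/-- Antipode:
`S(p_g # x) = σ_{x⁻¹ ⇀ g⁻¹}(x⁻¹, x)⁻¹ τ_x(g⁻¹, g)⁻¹ p_{x⁻¹ ⇀ g⁻¹} # x⁻¹`. -/
def antipodeHom (D : CocentralDatum G F) : D.Ext →ₗ[ℂ] D.Ext :=
  D.basis.constr ℂ fun i =>
    (((D.σ (i.2⁻¹ • i.1⁻¹) i.2⁻¹ i.2)⁻¹ * (D.τ i.2 i.1⁻¹ i.1)⁻¹ : ℂˣ) : ℂ) •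
      D.p (i.2⁻¹ • i.1⁻¹) i.2⁻¹

theorem comulHom_p (D : CocentralDatum G F) [Fintype G] (g : G) (x : F) :
    D.comulHom (D.p g x) =
      ∑ a : G, (D.τ x a (a⁻¹ * g) : ℂ) • (D.p a x ⊗ₜ[ℂ] D.p (a⁻¹ * g) x) := by
  simp [comulHom, p]

open Classical in
theorem counitHom_p (D : CocentralDatum G F) (g : G) (x : F) :
    D.counitHom (D.p g x) = if g = 1 then 1 else 0 := by
  simp [counitHom, p]

theorem antipodeHom_p (D : CocentralDatum G F) (g : G) (x : F) :
    D.antipodeHom (D.p g x) =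
      (((D.σ (x⁻¹ • g⁻¹) x⁻¹ x)⁻¹ * (D.τ x g⁻¹ g)⁻¹ : ℂˣ) : ℂ) • D.p (x⁻¹ • g⁻¹) x⁻¹ := by
  simp [antipodeHom, p]

/-- The coalgebra `ℂ^G #^τ ℂF`. -/
instance (D : CocentralDatum G F) [Fintype G] : Coalgebra ℂ D.Ext where
  comul := D.comulHom
  counit := D.counitHom
  coassoc := by
    apply hom_ext; intro g x
    simp only [LinearMap.comp_apply, comulHom_p, map_sum, map_smul, LinearMap.rTensor_tmul,
      LinearMap.lTensor_tmul, TensorProduct.sum_tmul, TensorProduct.tmul_sum, Finset.smul_sum,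
      TensorProduct.smul_tmul', smul_smul, LinearEquiv.coe_coe,
      TensorProduct.assoc_tmul]
    rw [Finset.sum_comm]
    refine Finset.sum_congr rfl fun a _ => ?_
    refine Fintype.sum_equiv (Equiv.mulLeft a⁻¹) _ _ fun c => ?_
    have hc := congrArg (fun u : ℂˣ => (u : ℂ)) (D.τ_cocycle x a (a⁻¹ * c) (c⁻¹ * g))
    simp only [Units.val_mul, mul_inv_cancel_left] at hc
    have e1 : a⁻¹ * c * (c⁻¹ * g) = a⁻¹ * g := by group
    have e2 : (a⁻¹ * c)⁻¹ * (a⁻¹ * g) = c⁻¹ * g := by group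
    rw [e1] at hc
    simp only [Equiv.coe_mulLeft, e2, ← TensorProduct.smul_tmul', TensorProduct.tmul_smul,
      smul_smul]
    rw [mul_comm, hc, mul_comm]
  rTensor_counit_comp_comul := by
    apply hom_ext; intro g x
    simp only [LinearMap.comp_apply, comulHom_p, map_sum, map_smul, LinearMap.rTensor_tmul,
      counitHom_p, TensorProduct.mk_apply]
    rw [Finset.sum_eq_single 1]
    · simp [D.τ_one_left]
    · intro b _ hb; simp [hb]
    · simp
  lTensor_counit_comp_comul := by
    apply hom_ext; intro g x
    simp only [LinearMap.comp_apply, comulHom_p, map_sum, map_smul, LinearMap.lTensor_tmul,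
      counitHom_p, LinearMap.flip_apply, TensorProduct.mk_apply]
    rw [Finset.sum_eq_single g]
    · simp [D.τ_one_right]
    · intro b _ hb
      have : b⁻¹ * g ≠ 1 := by
        intro e; exact hb (inv_mul_eq_one.mp e)
      simp [this]
    · simp

theorem comul_p (D : CocentralDatum G F) [Fintype G] (g : G) (x : F) :
    Coalgebra.comul (R := ℂ) (D.p g x) =
      ∑ a : G, (D.τ x a (a⁻¹ * g) : ℂ) • (D.p a x ⊗ₜ[ℂ] D.p (a⁻¹ * g) x) :=
  D.comulHom_p g x

open Classical in
theorem counit_p (D : CocentralDatum G F) [Fintype G] (g : G) (x : F) :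
    Coalgebra.counit (R := ℂ) (D.p g x) = if g = 1 then 1 else 0 :=
  D.counitHom_p g x

/-- The bialgebra `ℂ^G #_σ^τ ℂF`. -/
instance (D : CocentralDatum G F) [Fintype G] : Bialgebra ℂ D.Ext where
  counit_one := by
    rw [one_def, map_sum, Finset.sum_eq_single 1]
    · simp [counit_p]
    · intro b _ hb
      rw [counit_p, if_neg hb]
    · simp
  comul_one := by
    simp only [one_def, map_sum, comul_p, D.τ_one, Units.val_one, one_smul,
      Algebra.TensorProduct.one_def, TensorProduct.sum_tmul, TensorProduct.tmul_sum]
    rw [Finset.sum_comm]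
    conv_rhs => rw [Finset.sum_comm]
    refine Finset.sum_congr rfl fun a _ => ?_
    exact Fintype.sum_equiv (Equiv.mulLeft a⁻¹) _ _ fun c => rfl
  mul_compr₂_counit := by
    apply hom_ext; intro g x
    apply hom_ext; intro h y
    simp only [LinearMap.compr₂_apply, LinearMap.compl₁₂_apply, LinearMap.mul_apply', p_mul_p,
      counit_p]
    by_cases h1 : g = x • h
    · rw [if_pos h1]
      by_cases h2 : h = 1
      · subst h2
        simp only [smul_one] at h1
        subst h1
        simp [counit_p, D.σ_one]
      · have h3 : g ≠ 1 := by
          rw [h1]; intro e; exact h2 (MulAction.injective x (by simpa using e))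
        simp [counit_p, h3]
    · rw [if_neg h1]
      by_cases h2 : h = 1
      · subst h2
        simp only [smul_one] at h1
        simp [h1]
      · simp [h2]
  mul_compr₂_comul := by
    apply hom_ext; intro g x
    apply hom_ext; intro h y
    simp only [LinearMap.compr₂_apply, LinearMap.compl₁₂_apply, LinearMap.mul_apply', p_mul_p,
      comul_p, Finset.sum_mul_sum, smul_mul_smul_comm,
      Algebra.TensorProduct.tmul_mul_tmul]
    by_cases h1 : g = x • h
    · rw [if_pos h1, map_smul, comul_p, Finset.smul_sum]
      refine Finset.sum_congr rfl fun a _ => ?_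
      rw [Finset.sum_eq_single (x⁻¹ • a)]
      · have e1 : a = x • x⁻¹ • a := (smul_inv_smul x a).symm
        have e2 : a⁻¹ * g = x • ((x⁻¹ • a)⁻¹ * h) := by
          rw [smul_mul', smul_inv', smul_inv_smul, h1]
        have e3 : (x⁻¹ • a)⁻¹ * h = x⁻¹ • (a⁻¹ * g) := by rw [e2, inv_smul_smul]
        rw [if_pos e1, if_pos e2, e3, TensorProduct.smul_tmul_smul, smul_smul, smul_smul]
        have hc := congrArg (fun u : ℂˣ => (u : ℂ)) (D.compat x y a (a⁻¹ * g))
        simp only [Units.val_mul, mul_inv_cancel_left] at hc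
        rw [hc, mul_comm]
      · intro b _ hb
        have : ¬ a = x • b := by
          intro e; apply hb; rw [e, inv_smul_smul]
        rw [if_neg this, TensorProduct.zero_tmul, smul_zero]
      · simp
    · rw [if_neg h1, map_zero]
      symm
      refine Finset.sum_eq_zero fun a _ => Finset.sum_eq_zero fun b _ => ?_
      by_cases h2 : a = x • b
      · have : ¬ a⁻¹ * g = x • (b⁻¹ * h) := by
          intro e
          rw [smul_mul', smul_inv', ← h2] at e
          exact h1 (mul_left_cancel e)
        rw [if_neg this, TensorProduct.tmul_zero, smul_zero]
      · rw [if_neg h2, TensorProduct.zero_tmul, smul_zero]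

/-- The Hopf algebra `ℂ^G #_σ^τ ℂF`. -/
instance (D : CocentralDatum G F) [Fintype G] : HopfAlgebra ℂ D.Ext where
  antipode := D.antipodeHom
  mul_antipode_rTensor_comul := by
    apply hom_ext; intro g x
    simp only [LinearMap.comp_apply, comul_p, map_sum, map_smul, LinearMap.rTensor_tmul,
      antipodeHom_p, LinearMap.mul'_apply, counit_p, smul_mul_assoc, p_mul_p,
      Algebra.linearMap_apply, Algebra.algebraMap_eq_smul_one]
    by_cases hg : g = 1
    · subst hg
      rw [if_pos rfl, one_smul, one_def]
      refine Fintype.sum_equiv ((Equiv.inv G).trans (MulAction.toPerm x⁻¹)) _ _ fun a => ?_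
      simp only [mul_one, if_true, inv_mul_cancel, smul_smul, ← Units.val_mul, D.τ_inv]
      simp
    · rw [if_neg hg, zero_smul]
      refine Finset.sum_eq_zero fun a _ => ?_
      rw [if_neg, smul_zero, smul_zero]
      intro e
      have e' := MulAction.injective _ e
      exact hg (by simpa using e')
  mul_antipode_lTensor_comul := by
    apply hom_ext; intro g x
    simp only [LinearMap.comp_apply, comul_p, map_sum, map_smul, LinearMap.lTensor_tmul,
      antipodeHom_p, LinearMap.mul'_apply, counit_p, mul_smul_comm, p_mul_p,
      Algebra.linearMap_apply, Algebra.algebraMap_eq_smul_one]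
    by_cases hg : g = 1
    · subst hg
      rw [if_pos rfl, one_smul, one_def]
      refine Finset.sum_congr rfl fun a _ => ?_
      simp only [mul_one, inv_inv, mul_inv_cancel, smul_smul,
        ← Units.val_mul, D.σ_inv]
      simp
    · rw [if_neg hg, zero_smul]
      refine Finset.sum_eq_zero fun a _ => ?_
      have : ¬ a = (a⁻¹ * g)⁻¹ := by
        intro e
        rw [mul_inv_rev, inv_inv] at e
        exact hg (by simpa using e)
      rw [smul_inv_smul, if_neg this, smul_zero, smul_zero]

/-- The cocycle `σ` is trivial. -/
def SigmaTrivial (D : CocentralDatum G F) : Prop := ∀ g x y, D.σ g x y = 1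

end CocentralDatum

/-- The set of involutions of a group; as in the formula `Tr(S) = i_G` for `ℂG`, the identity
is counted as an involution. -/
def involutions (G : Type*) [Group G] : Set G := {g | g ^ 2 = 1}

/-- The set of all `w` with `w ⇀ g = g` or `w ⇀ g = g⁻¹`. -/
def extendedStabilizer {G : Type*} (F : Type*) [Group G] [Group F] [MulDistribMulAction F G]
    (g : G) : Set F := {w | w • g = g ∨ w • g = g⁻¹}

end

/-! The antipode permutes the basis up to scalars: it sends `p_g # x` to a multiple of `p_h # x⁻¹`
with `h = x⁻¹ ⇀ g⁻¹`. Its trace is therefore the sum of these scalars over the pairs with `x² = 1`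
and `x ⇀ g = g⁻¹` (`trace_antipode`).

If `|F|` is odd, only `x = 1` survives; the scalar is then `1` and the condition reads `g = g⁻¹`, so
the sum counts involutions.

In the second case, the stabilizer hypothesis turns `x ⇀ g = g⁻¹` into `g² = 1` and `x ⇀ g = g`. For
fixed `g` the sum thus runs over the subgroup `I_F ∩ F_g`. There, with `σ` trivial, the
compatibility condition makes `x ↦ τ_x(g, g)⁻¹` a character, whose sum is the order of the subgroup
or zero (`sum_tau_inv_nonneg`). Strict positivity comes from `g = 1`, where `τ` is normalized. -/

namespace CocentralDatum

variable {G : Type*} {F : Type*} [Group G] [Group F] [MulDistribMulAction F G]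

/-! ### The trace as a sum over fixed basis lines. -/

open Classical in
/-- The trace of the antipode, computed on the basis of the elements `p_g # x`. -/
theorem trace_antipode (D : CocentralDatum G F) [Fintype G] [Fintype F] :
    LinearMap.trace ℂ D.Ext (HopfAlgebra.antipode ℂ (A := D.Ext)) =
      ∑ g : G, ∑ x : F, if x⁻¹ • g⁻¹ = g ∧ x⁻¹ = x then
        (((D.σ g x⁻¹ x)⁻¹ * (D.τ x g⁻¹ g)⁻¹ : ℂˣ) : ℂ) else 0 := by
  have hS : HopfAlgebra.antipode ℂ (A := D.Ext) = D.antipodeHom := rfl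
  rw [hS, LinearMap.trace_eq_matrix_trace ℂ D.basis, Matrix.trace, Fintype.sum_prod_type]
  refine Finset.sum_congr rfl fun g _ => Finset.sum_congr rfl fun x _ => ?_
  have hp : D.basis (g, x) = D.p g x := rfl
  rw [Matrix.diag_apply, LinearMap.toMatrix_apply, hp, antipodeHom_p, p, map_smul,
    Module.Basis.repr_self, Finsupp.smul_apply, Finsupp.single_apply]
  simp only [Prod.mk.injEq]
  split_ifs with h
  · rw [h.1, smul_eq_mul, mul_one]
  · rw [smul_zero]

/-! ### Groups `F` of odd order. -/

/-- If `|F|` is odd, the trace of the antipode is the number of involutions of `G`. -/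
theorem trace_antipode_of_odd (D : CocentralDatum G F) [Fintype G] [Fintype F]
    (hF : Odd (Nat.card F)) :
    LinearMap.trace ℂ D.Ext (HopfAlgebra.antipode ℂ (A := D.Ext)) =
      ((involutions G).ncard : ℂ) := by
  classical
  have hinv (x : F) (hx : x⁻¹ = x) : x = 1 := by
    have h2 : orderOf x ∣ 2 :=
      orderOf_dvd_of_pow_eq_one (by rw [pow_two, ← inv_eq_iff_mul_eq_one, hx])
    have h1 := Nat.dvd_gcd h2 (orderOf_dvd_natCard x)
    rwa [(Nat.coprime_two_left.mpr hF).gcd_eq_one, Nat.dvd_one, orderOf_eq_one_iff] at h1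
  have hcard : (involutions G).ncard = (Finset.univ.filter fun g : G => g⁻¹ = g).card := by
    rw [← Set.ncard_coe_finset]
    congr 1
    ext g
    simp [involutions, pow_two, inv_eq_iff_mul_eq_one]
  rw [trace_antipode, hcard, Finset.card_filter, Nat.cast_sum]
  refine Finset.sum_congr rfl fun g _ => ?_
  rw [Finset.sum_eq_single 1]
  · simp [D.σ_one_left, D.τ_one]
  · intro x _ hx
    exact if_neg fun h => hx (hinv x h.2)
  · simp

/-! ### Trivial `σ`: character sums and positivity. -/

/-- If `σ` is trivial, then `x ↦ τ_x(a, b)⁻¹` is a character on every subgroup of `F` that fixes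
`a` and `b`. -/
def tauInvHom (D : CocentralDatum G F) (hσ : D.SigmaTrivial) (a b : G) (K : Subgroup F)
    (ha : ∀ x ∈ K, x • a = a) (hb : ∀ x ∈ K, x • b = b) : K →* ℂˣ where
  toFun x := (D.τ x a b)⁻¹
  map_one' := by simp [D.τ_one]
  map_mul' x y := by
    -- The last factor is `τ_y(x⁻¹ ⇀ a, x⁻¹ ⇀ b)`; since `x⁻¹` also lies in `K`, it is `τ_y(a, b)`.
    have h := D.compat x y a b
    rw [ha _ (K.inv_mem x.2), hb _ (K.inv_mem x.2), hσ, hσ, hσ, one_mul, one_mul, one_mul] at h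
    rw [Subgroup.coe_mul, h, mul_inv]

/-- If `σ` is trivial, the sum of `τ_x(a, b)⁻¹` over a subgroup that fixes `a` and `b` is the
order of the subgroup or zero. -/
theorem sum_tau_inv_nonneg (D : CocentralDatum G F) (hσ : D.SigmaTrivial) (a b : G)
    (K : Subgroup F) [Fintype K] (ha : ∀ x ∈ K, x • a = a) (hb : ∀ x ∈ K, x • b = b) :
    0 ≤ ∑ x : K, (((D.τ x a b)⁻¹ : ℂˣ) : ℂ) := by
  classical
  -- Orthogonality with the trivial character; the values are moved from `ℂˣ` to `ℂ`, where they can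
  -- be added.
  have h := sum_hom_units ((Units.coeHom ℂ).comp (D.tauInvHom hσ a b K ha hb))
  have e : ∑ x : K, (((D.τ x a b)⁻¹ : ℂˣ) : ℂ) =
      ∑ x : K, ((Units.coeHom ℂ).comp (D.tauInvHom hσ a b K ha hb)) x := rfl
  rw [e, h]
  split_ifs
  · exact Nat.cast_nonneg _
  · simp

/-- If `σ` is trivial, the involutions of `F` form a subgroup and no element of `F` inverts an
element of `G` that it does not fix, then the trace of the antipode is positive. -/
theorem trace_antipode_pos (D : CocentralDatum G F) [Fintype G] [Fintype F]
    (hσ : D.SigmaTrivial) (hK : ∃ K : Subgroup F, (K : Set F) = involutions F)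
    (hst : ∀ g : G, (MulAction.stabilizer F g : Set F) = extendedStabilizer F g) :
    0 < LinearMap.trace ℂ D.Ext (HopfAlgebra.antipode ℂ (A := D.Ext)) := by
  classical
  obtain ⟨K, hK⟩ := hK
  have hmem (x : F) : x⁻¹ = x ↔ x ∈ K := by
    rw [← SetLike.mem_coe, hK, involutions, Set.mem_ofPred_eq, pow_two, inv_eq_iff_mul_eq_one]
  -- The only use of the stabilizer hypothesis: an `x` that inverts `g` must fix it, so `g⁻¹ = g`.
  have hfix (g : G) (x : F) : x⁻¹ • g⁻¹ = g ↔ g⁻¹ = g ∧ x • g = g := by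
    rw [inv_smul_eq_iff]
    constructor
    · intro h
      have hx : x ∈ extendedStabilizer F g := Or.inr h.symm
      rw [← hst g] at hx
      have hx' : x • g = g := hx
      exact ⟨h.trans hx', hx'⟩
    · rintro ⟨h, hx⟩
      rw [h, hx]
  rw [trace_antipode]
  -- The order on `ℂ` is the one in which `0 < z` forces `z` to be real.
  refine Finset.sum_pos' (fun g _ => ?_) ⟨1, Finset.mem_univ _, ?_⟩
  · by_cases hg : g⁻¹ = g
    -- A subgroup because `I_F` is one; its elements index exactly the nonzero terms for this `g`.
    · let L : Subgroup F := K ⊓ MulAction.stabilizer F g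
      have hL : ∀ x ∈ L, x • g = g := fun x hx => hx.2
      have : Fintype L := Fintype.ofFinite L
      have h := D.sum_tau_inv_nonneg hσ g g L hL hL
      rw [← Finset.sum_subtype (Finset.univ.filter fun x : F => x ∈ L) (p := (· ∈ L))
        (by simp) fun x => (((D.τ x g g)⁻¹ : ℂˣ) : ℂ), Finset.sum_filter] at h
      refine h.trans_eq (Finset.sum_congr rfl fun x _ => ?_)
      refine if_congr ?_ ?_ rfl
      · rw [hfix, hmem, Subgroup.mem_inf, MulAction.mem_stabilizer_iff]
        tauto
      · rw [hσ, hg, inv_one, one_mul]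
    · exact (Finset.sum_eq_zero fun x _ => if_neg fun h => hg ((hfix g x).mp h.1).1).ge
  -- At `g = 1` every nonzero term is `1`, and `x = 1` gives such a term.
  · refine Finset.sum_pos' (fun x _ => ?_) ⟨1, Finset.mem_univ _, ?_⟩
    · split_ifs
      · simp [hσ 1, D.τ_one_right]
      · exact le_rfl
    · simp [hσ 1, D.τ_one_right]

end CocentralDatum

theorem proposition5p3 {G : Type*} {F : Type*} [Group G] [Fintype G] [Group F] [Finite F]
    [MulDistribMulAction F G] (D : CocentralDatum G F) :
    (Odd (Nat.card F) →
      LinearMap.trace ℂ D.Ext (HopfAlgebra.antipode ℂ (A := D.Ext)) =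
        ((involutions G).ncard : ℂ)) ∧
    (D.SigmaTrivial →
      (∃ K : Subgroup F, (K : Set F) = involutions F) →
      (∀ g : G, (MulAction.stabilizer F g : Set F) = extendedStabilizer F g) →
      0 < LinearMap.trace ℂ D.Ext (HopfAlgebra.antipode ℂ (A := D.Ext))) := by
  have := Fintype.ofFinite F
  exact ⟨D.trace_antipode_of_odd, D.trace_antipode_pos⟩
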